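/- **Theorem (Convergence of continuous-time Adam).** Let $\xi$ be a random variable on a probability space $(\Omega,\mathcal F,\mathbb P)$ with values in a measurable space $\Xi$, and let $f:\mathbb R^d\times\Xi\to\mathbb R$ be measurable and such that $x\mapsto f(x,s)$ is differentiable for every $s\in\Xi$, with gradient $\nabla f(x,s)$. Assume that 1. almost surely, $f(\cdot,\xi)$ is continuously differentiable; there is $x_*\in\mathbb R^d$ with $\mathbb E|f(x_*,\xi)|<\infty$ and $\mathbb E\|\nabla f(x_*,\xi)\|^2<\infty$; and for every compact $K\subset\mathbb R^d$ there is $L_K>0$ such that $\mathbb E\|\nabla f(x,\xi)-\nabla f(y,\xi)\|^2\le L_K^2\|x-y\|^2$ for all $x,y\in K$ (in particular the left-hand side is finite). Set $F(x)=\mathbb E f(x,\xi)$, let $S(x)\in\mathbb R^d$ be the vector with coordinates $S_i(x)=\mathbb E\big[(\partial_i f(x,\xi))^2\big]$, and let $\mathcal S=\{x:\nabla F(x)=0\}$ be the set of critical points of $F$. Assume moreover that 2. $F$ is coercive, i.e. $F(x)\to+\infty$ as $\|x\|\to\infty$; 3. $S_i(x)>0$ for all $x\in\mathbb R^d$ and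 all $i$; 4. $\bar\alpha,\bar\beta:[0,\infty)\to[0,1)$ are such that the limits $a=\lim_{\gamma\downarrow0}\frac{1-\bar\alpha(\gamma)}{\gamma}$ and $b=\lim_{\gamma\downarrow0}\frac{1-\bar\beta(\gamma)}{\gamma}$ exist, with $a>0$, $b>0$ and $b\le 4a$. Let $\varepsilon>0$ and $x_0\in\mathbb R^d$, and suppose that $F(\mathcal S)$ has empty interior. Let $z=(x,m,v):[0,\infty)\to\mathbb R^d\times\mathbb R^d\times[0,\infty)^d$ be the global solution with $z(0)=(x_0,0,0)$ of $$\dot x(t)=-\frac{(1-e^{-at})^{-1}m(t)}{\varepsilon+\sqrt{(1-e^{-bt})^{-1}v(t)}},\qquad \dot m(t)=a\big(\nabla F(x(t))-m(t)\big),\qquad \dot v(t)=b\big(S(x(t))-v(t)\big)\qquad(t>0),$$ where quotients and square roots of vectors are taken coordinatewise, and a global solution is a map that is continuous on $[0,\infty)$, continuously differentiable on $(0,\infty)$, and satisfies the equations for every $t>0$. Then $\mathcal S$ is non-empty and, as $t\to\infty$, $$\inf_{y\in\mathcal S}\|x(t)-y\|\to0,\qquad m(t)\to0,\qquad S(x(t))-v(t)\to0.$$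 -/

import Mathlib

open MeasureTheory Filter Topology

namespace Adam

/-- The space `ℝᵈ` with the standard Euclidean norm. -/
abbrev E (d : ℕ) : Type := EuclideanSpace ℝ (Fin d)

/-- The space `𝒵 = ℝᵈ × ℝᵈ × ℝᵈ` of triples `z = (x, m, v)`. -/
abbrev Z (d : ℕ) : Type := E d × E d × E d

/-- `𝒵₊`: the triples `(x, m, v)` whose last block has nonnegative coordinates. -/
def ZPlus (d : ℕ) : Set (Z d) := {z | ∀ i, 0 ≤ z.2.2 i}

noncomputable section

section Model

variable {d : ℕ} {Ω Ξ : Type*} [MeasurableSpace Ω] [MeasurableSpace Ξ]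

/-- `∇f(x, s)`, the gradient with respect to `x`. -/
def gradf (f : E d → Ξ → ℝ) (x : E d) (s : Ξ) : E d := gradient (fun y => f y s) x

/-- `F(x) = 𝔼 f(x, ξ)`. -/
def objective (P : Measure Ω) (ξ : Ω → Ξ) (f : E d → Ξ → ℝ) (x : E d) : ℝ :=
  ∫ ω, f x (ξ ω) ∂P

/-- `S(x) = 𝔼 (∇f(x, ξ) ⊙ ∇f(x, ξ))`, the coordinatewise second moment of the gradient. -/
def secondMoment (P : Measure Ω) (ξ : Ω → Ξ) (f : E d → Ξ → ℝ) (x : E d) : E d :=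
  WithLp.toLp 2 fun i => ∫ ω, (gradf f x (ξ ω) i) ^ 2 ∂P

/-- The standing assumptions on the random function `f(·, ξ)`. -/
structure Model (P : Measure Ω) (ξ : Ω → Ξ) (f : E d → Ξ → ℝ) : Prop where
  measurable : Measurable fun p : E d × Ξ => f p.1 p.2
  differentiable : ∀ s, Differentiable ℝ fun x => f x s
  contDiff : ∀ᵐ ω ∂P, ContDiff ℝ 1 fun x => f x (ξ ω)
  exists_integrable : ∃ x : E d, Integrable (fun ω => f x (ξ ω)) P ∧
    Integrable (fun ω => ‖gradf f x (ξ ω)‖ ^ 2) P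
  lipschitz : ∀ K : Set (E d), IsCompact K → ∃ L : ℝ, 0 < L ∧ ∀ x ∈ K, ∀ y ∈ K,
    Integrable (fun ω => ‖gradf f x (ξ ω) - gradf f y (ξ ω)‖ ^ 2) P ∧
      ∫ ω, ‖gradf f x (ξ ω) - gradf f y (ξ ω)‖ ^ 2 ∂P ≤ L ^ 2 * ‖x - y‖ ^ 2

end Model

/-- `F` is coercive: `F(x) → +∞` as `‖x‖ → ∞`. -/
def Coercive {d : ℕ} (F : E d → ℝ) : Prop :=
  Tendsto F (comap (fun x => ‖x‖) atTop) atTop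

/-- The hyperparameters `α = αbar(γ)`, `β = βbar(γ)` lie in `[0, 1)` and approach `1` at rates
`a` and `b` as the step size `γ` tends to `0`, with `a, b > 0` and `b ≤ 4 a`. -/
structure AsymptoticRegime (αbar βbar : ℝ → ℝ) (a b : ℝ) : Prop where
  alpha_mem : ∀ γ, 0 ≤ γ → αbar γ ∈ Set.Ico (0 : ℝ) 1
  beta_mem : ∀ γ, 0 ≤ γ → βbar γ ∈ Set.Ico (0 : ℝ) 1
  alpha_tendsto : Tendsto (fun γ => (1 - αbar γ) / γ) (𝓝[>] 0) (𝓝 a)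
  beta_tendsto : Tendsto (fun γ => (1 - βbar γ) / γ) (𝓝[>] 0) (𝓝 b)
  a_pos : 0 < a
  b_pos : 0 < b
  b_le : b ≤ 4 * a

/-- The set `∇F⁻¹({0})` of critical points of `F`. -/
def criticalSet {d : ℕ} (F : E d → ℝ) : Set (E d) := {x | gradient F x = 0}

/-- The vector field `h(t, (x, m, v))` of the continuous-time Adam dynamics. -/
def field {d : ℕ} (a b ε : ℝ) (F : E d → ℝ) (S : E d → E d) (t : ℝ) (z : Z d) : Z d :=
  (WithLp.toLp 2 fun i =>
      -((1 - Real.exp (-a * t))⁻¹ * z.2.1 i /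
        (ε + Real.sqrt ((1 - Real.exp (-b * t))⁻¹ * z.2.2 i))),
    a • (gradient F z.1 - z.2.1),
    b • (S z.1 - z.2.2))

/-- `z : [0, ∞) → 𝒵₊` is a global solution of `ż(t) = h(t, z(t))`, `z(0) = (x₀, 0, 0)`;
only the values `z t` for `t ≥ 0` matter. -/
structure IsGlobalSolution {d : ℕ} (a b ε : ℝ) (F : E d → ℝ) (S : E d → E d) (x₀ : E d)
    (z : ℝ → Z d) : Prop where
  mem_ZPlus : ∀ t, 0 ≤ t → z t ∈ ZPlus d
  continuousOn : ContinuousOn z (Set.Ici 0)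
  contDiffOn : ContDiffOn ℝ 1 z (Set.Ioi 0)
  ode : ∀ t, 0 < t → HasDerivAt z (field a b ε F S t (z t)) t
  init : z 0 = (x₀, 0, 0)

end

end Adam

/-!
The proof is a Lyapunov argument closed by Barbalat's lemma.

Write `s_i = √(v_i / (1 - exp (-b t)))`. The energy
`F(x) + ∑ i, m_i ^ 2 / (2 a (1 - exp (-a t)) (ε + s_i))` has derivative at most
`-∑ i, ε m_i ^ 2 / (ε + s_i) ^ 2` along the solution (`IsGlobalSolution.exists_hasDerivAt_energy`).
The cross terms in `∇F` cancel; the remaining danger is the decay of the weight `s_i`, at relative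
rate at most `b / (2 (1 - exp (-b t)))`, and the condition `b ≤ 4 a` is what keeps it below the
damping (`rate_le`). Since `S > 0` forces `v > 0` for positive times, the square roots are
differentiable.

By coercivity the energy bounds `x`, hence `∇F(x)` and `S(x)`, hence the averages `m` and `v`
(`IsGlobalSolution.exists_isBounded`). The dissipation is then at least a constant times
`‖m‖ ^ 2`, and Barbalat's lemma (`eventually_lt_of_hasDerivAt_le`) gives `m → 0`. A second use of
it, now for `m` itself, gives `m' = a (∇F(x) - m) → 0`, so `∇F(x(t)) → 0`, and compactness turns
this into convergence to the critical set. Finally `x' → 0`, so the forcing `S(x)` of the linear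
equation for `v` varies slowly and `v` follows it (`relaxation_tendsto`).

On the probabilistic side `F` has to be differentiable with locally Lipschitz gradient. The gradient
of `f` is Lipschitz only in mean square, so there is no integrable domination to differentiate under
the expectation; instead the first-order Taylor remainder, written as an integral along a segment,
has mean `O(‖h‖ ^ 2)` by Tonelli's theorem (`Model.lintegral_remainder_le`).
-/

namespace Adam

/-! ### Scalar differential inequalities -/

/-- Comparison for the relaxation equation `u' = c (g - u)`: if `g ≤ K`, the excess of `u` over `K`
decays at least like `exp (-c t)`, because `exp (c r) (u r - K)` is nonincreasing. -/
theorem relaxation_le {u g : ℝ → ℝ} {c K s t : ℝ} (hc : 0 < c) (hst : s ≤ t)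
    (hu : ∀ r ∈ Set.Icc s t, HasDerivAt u (c * (g r - u r)) r)
    (hg : ∀ r ∈ Set.Icc s t, g r ≤ K) :
    u t ≤ K + Real.exp (-c * (t - s)) * (u s - K) := by
  have hd : ∀ r ∈ Set.Icc s t, HasDerivAt (fun r => Real.exp (c * r) * (u r - K))
      (Real.exp (c * r) * (c * (g r - K))) r := by
    intro r hr
    have h1 : HasDerivAt (fun r => Real.exp (c * r)) (Real.exp (c * r) * c) r := by
      simpa using ((hasDerivAt_id r).const_mul c).exp
    refine (h1.mul ((hu r hr).sub_const K)).congr_deriv ?_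
    ring
  have hanti : AntitoneOn (fun r => Real.exp (c * r) * (u r - K)) (Set.Icc s t) := by
    refine antitoneOn_of_deriv_nonpos (convex_Icc s t)
      (fun r hr => (hd r hr).continuousAt.continuousWithinAt)
      (fun r hr => (hd r (interior_subset hr)).differentiableAt.differentiableWithinAt)
      (fun r hr => ?_)
    rw [(hd r (interior_subset hr)).deriv]
    have := hg r (interior_subset hr)
    exact mul_nonpos_of_nonneg_of_nonpos (Real.exp_pos _).le
      (mul_nonpos_of_nonneg_of_nonpos hc.le (by linarith))
  have h := hanti (Set.left_mem_Icc.2 hst) (Set.right_mem_Icc.2 hst) hst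
  have hexp : Real.exp (-c * (t - s)) * Real.exp (c * t) = Real.exp (c * s) := by
    rw [← Real.exp_add]; congr 1; ring
  have hpos := Real.exp_pos (c * t)
  refine le_of_mul_le_mul_left ?_ hpos
  have h' : Real.exp (c * t) * (u t - K) ≤ Real.exp (c * s) * (u s - K) := h
  rw [← hexp] at h'
  nlinarith [h']

/-- Solutions of `u' = c (g - u)` with bounded forcing are bounded. -/
theorem relaxation_abs_le {u g : ℝ → ℝ} {c C s : ℝ} (hc : 0 < c)
    (hu : ∀ r, s ≤ r → HasDerivAt u (c * (g r - u r)) r) (hg : ∀ r, s ≤ r → |g r| ≤ C) :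
    ∀ t, s ≤ t → |u t| ≤ C + |u s| := by
  intro t hst
  have hC : 0 ≤ C := (abs_nonneg _).trans (hg s le_rfl)
  have hexp : Real.exp (-c * (t - s)) ≤ 1 :=
    Real.exp_le_one_iff.2 (by nlinarith)
  have hpos := Real.exp_pos (-c * (t - s))
  have h1 := relaxation_le hc hst (fun r hr => hu r hr.1)
    (fun r hr => (le_abs_self _).trans (hg r hr.1))
  have h2 := relaxation_le (u := fun r => -u r) (g := fun r => -g r) hc hst
    (fun r hr => (hu r hr.1).neg.congr_deriv (by ring))
    (fun r hr => (neg_le_abs _).trans (hg r hr.1))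
  have h3 := le_abs_self (u s)
  have h4 := neg_le_abs (u s)
  have h0 := abs_nonneg (u s)
  rw [abs_le]
  constructor <;> nlinarith

/-- Upper half of `relaxation_tendsto`: on a window of length `T` with `exp (-c T)` small, the initial
excess is forgotten while the forcing has barely moved. -/
theorem relaxation_eventually_sub_le {u g : ℝ → ℝ} {c C s : ℝ} (hc : 0 < c)
    (hu : ∀ r, s ≤ r → HasDerivAt u (c * (g r - u r)) r)
    (hg : ∀ r, s ≤ r → |g r| ≤ C) (huC : ∀ r, s ≤ r → |u r| ≤ C)
    (hslow : ∀ T > 0, ∀ δ > 0, ∀ᶠ t in atTop, ∀ r ∈ Set.Icc t (t + T), |g r - g t| ≤ δ)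
    {δ : ℝ} (hδ : 0 < δ) : ∀ᶠ t in atTop, u t - g t ≤ δ := by
  have hlim : Tendsto (fun T : ℝ => Real.exp (-c * T) * (2 * C)) atTop (𝓝 0) := by
    have : Tendsto (fun T : ℝ => -c * T) atTop atBot :=
      tendsto_id.const_mul_atTop_of_neg (by linarith)
    simpa using (Real.tendsto_exp_atBot.comp this).mul_const (2 * C)
  obtain ⟨T, hT, hT0⟩ :=
    ((hlim.eventually_lt_const (half_pos hδ)).and (eventually_gt_atTop 0)).exists
  obtain ⟨N, hN⟩ := eventually_atTop.1
    ((hslow T hT0 (δ / 4) (by linarith)).and (eventually_ge_atTop s))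
  filter_upwards [eventually_ge_atTop (N + T)] with t ht
  obtain ⟨h1, h2⟩ := hN (t - T) (by linarith)
  rw [sub_add_cancel] at h1
  have h3 := relaxation_le (K := g (t - T) + δ / 4) hc (by linarith : t - T ≤ t)
    (fun r hr => hu r (h2.trans hr.1))
    (fun r hr => by have := (abs_le.1 (h1 r hr)).2; linarith)
  rw [sub_sub_cancel] at h3
  have h4 := (abs_le.1 (h1 t ⟨by linarith, le_rfl⟩)).1
  have h5 := (abs_le.1 (hg _ h2)).1
  have h6 := (abs_le.1 (huC _ h2)).2
  have h7 : Real.exp (-c * T) * (u (t - T) - (g (t - T) + δ / 4)) ≤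
      Real.exp (-c * T) * (2 * C) :=
    mul_le_mul_of_nonneg_left (by linarith) (Real.exp_pos _).le
  linarith

/-- A relaxation equation follows its forcing when the forcing is asymptotically constant on
windows of bounded length. -/
theorem relaxation_tendsto {u g : ℝ → ℝ} {c C s : ℝ} (hc : 0 < c)
    (hu : ∀ r, s ≤ r → HasDerivAt u (c * (g r - u r)) r) (hg : ∀ r, s ≤ r → |g r| ≤ C)
    (hslow : ∀ T > 0, ∀ δ > 0, ∀ᶠ t in atTop, ∀ r ∈ Set.Icc t (t + T), |g r - g t| ≤ δ) :
    Tendsto (fun t => g t - u t) atTop (𝓝 0) := by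
  have huC := relaxation_abs_le hc hu hg
  have hg' : ∀ r, s ≤ r → |g r| ≤ C + |u s| :=
    fun r hr => (hg r hr).trans (le_add_of_nonneg_right (abs_nonneg _))
  rw [Metric.tendsto_nhds]
  intro δ hδ
  have h1 := relaxation_eventually_sub_le hc hu hg' huC hslow (half_pos hδ)
  have h2 := relaxation_eventually_sub_le (u := fun r => -u r) (g := fun r => -g r)
    (C := C + |u s|) hc (fun r hr => (hu r hr).neg.congr_deriv (by ring))
    (fun r hr => by simpa using hg' r hr)
    (fun r hr => by simpa using huC r hr)
    (fun T hT δ hδ => by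
      filter_upwards [hslow T hT δ hδ] with t ht r hr
      rw [← abs_neg]; convert ht r hr using 2; ring)
    (half_pos hδ)
  filter_upwards [h1, h2] with t h1 h2
  rw [Real.dist_eq, sub_zero, abs_lt]
  constructor <;> linarith

/-- Barbalat's lemma, in one-sided form: if `u` converges and decreases at rate at least `ψ`, with
`ψ` Lipschitz, then `ψ` is eventually below any positive number. -/
theorem eventually_lt_of_hasDerivAt_le {u u' ψ : ℝ → ℝ} {s l C : ℝ}
    (hu : ∀ r, s ≤ r → HasDerivAt u (u' r) r) (hle : ∀ r, s ≤ r → u' r ≤ -ψ r)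
    (hl : Tendsto u atTop (𝓝 l))
    (hψ : ∀ r t, s ≤ r → r ≤ t → |ψ t - ψ r| ≤ C * (t - r)) {δ : ℝ} (hδ : 0 < δ) :
    ∀ᶠ t in atTop, ψ t < δ := by
  have hC : 0 ≤ C := by
    have := (abs_nonneg _).trans (hψ s (s + 1) le_rfl (by linarith))
    linarith
  -- the window length, chosen so that `ψ` varies by at most `δ / 2` on a window
  set τ : ℝ := δ / (2 * (C + 1)) with hτ
  have hτ0 : 0 < τ := by positivity
  have hCτ : C * τ ≤ δ / 2 := by
    rw [hτ, mul_div_assoc', div_le_div_iff₀ (by positivity) (by norm_num)]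
    nlinarith
  have hdiff : Tendsto (fun t => u t - u (t + τ)) atTop (𝓝 0) := by
    simpa using hl.sub (hl.comp (tendsto_atTop_add_const_right atTop τ tendsto_id))
  filter_upwards [hdiff.eventually_lt_const (by positivity : 0 < τ * (δ / 2)),
    eventually_ge_atTop s] with t h1 h2
  by_contra! h3
  have hslope : u (t + τ) - u t ≤ -(δ / 2) * (t + τ - t) := by
    refine (convex_Icc t (t + τ)).image_sub_le_mul_sub_of_deriv_le
      (fun r hr => (hu r (h2.trans hr.1)).continuousAt.continuousWithinAt)
      (fun r hr => (hu r (h2.trans (interior_subset hr).1)).differentiableAt.differentiableWithinAt)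
      (fun r hr => ?_) t ⟨le_rfl, by linarith⟩ (t + τ) ⟨by linarith, le_rfl⟩ (by linarith)
    have hr' := interior_subset hr
    rw [(hu r (h2.trans hr'.1)).deriv]
    have h4 := hle r (h2.trans hr'.1)
    have h5 := (abs_le.1 (hψ t r h2 hr'.1)).1
    have h6 : C * (r - t) ≤ C * τ := mul_le_mul_of_nonneg_left (by linarith [hr'.2]) hC
    linarith
  linarith [hslope, mul_comm τ (δ / 2), add_sub_cancel_left t τ,
    congrArg (fun y => -(δ / 2) * y) (add_sub_cancel_left t τ)]

/-- Two-sided form of Barbalat's lemma: a convergent function with Lipschitz derivative has a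
derivative tending to zero. -/
theorem tendsto_deriv_zero_of_tendsto {u ψ : ℝ → ℝ} {s l C : ℝ}
    (hu : ∀ r, s ≤ r → HasDerivAt u (ψ r) r) (hl : Tendsto u atTop (𝓝 l))
    (hψ : ∀ r t, s ≤ r → r ≤ t → |ψ t - ψ r| ≤ C * (t - r)) :
    Tendsto ψ atTop (𝓝 0) := by
  rw [Metric.tendsto_nhds]
  intro δ hδ
  filter_upwards [eventually_lt_of_hasDerivAt_le (u := fun r => -u r) (u' := fun r => -ψ r)
      (fun r hr => (hu r hr).neg) (fun r hr => le_rfl) hl.neg hψ hδ,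
    eventually_lt_of_hasDerivAt_le (ψ := fun r => -ψ r) hu (fun r _ => (neg_neg _).ge) hl
      (fun r t hr ht => by rw [← abs_neg]; convert hψ r t hr ht using 2; ring) hδ] with t h1 h2
  rw [Real.dist_eq, sub_zero, abs_lt]
  constructor <;> linarith

/-! ### Dissipation in one coordinate -/

/-- The only place where `b ≤ 4 a` enters: convexity of `exp` gives
`1 - exp (-b t) ≥ (b / 4 a) (1 - q ^ 4)` with `q = exp (-a t)`. -/
theorem rate_le {a b t : ℝ} (ha : 0 < a) (hb : 0 < b) (hab : b ≤ 4 * a) (ht : 0 < t) :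
    b / (4 * a * (1 - Real.exp (-b * t))) ≤
      (1 + (1 - Real.exp (-a * t))) / (2 * (1 - Real.exp (-a * t))) := by
  set q := Real.exp (-a * t) with hq
  have hq0 : 0 < q := Real.exp_pos _
  have hq1 : q < 1 := Real.exp_lt_one_iff.2 (by nlinarith)
  have hp1 : Real.exp (-b * t) < 1 := Real.exp_lt_one_iff.2 (by nlinarith)
  have h4 : Real.exp (4 * (-a * t)) = q ^ 4 := by
    rw [hq, ← Real.exp_nat_mul]; norm_num
  have hs : b / (4 * a) ≤ 1 := (div_le_one (by positivity)).2 hab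
  have hconv := convexOn_exp.2 (Set.mem_univ (0 : ℝ)) (Set.mem_univ (4 * (-a * t)))
    (sub_nonneg.2 hs) (by positivity : 0 ≤ b / (4 * a)) (by ring)
  have harg : (1 - b / (4 * a)) • (0 : ℝ) + (b / (4 * a)) • (4 * (-a * t)) = -b * t := by
    simp only [smul_eq_mul]; field_simp; ring
  rw [harg, h4] at hconv
  simp only [smul_eq_mul, Real.exp_zero, mul_one] at hconv
  have hβ : b * (1 - q ^ 4) ≤ 4 * a * (1 - Real.exp (-b * t)) := by
    have : b / (4 * a) * (1 - q ^ 4) ≤ 1 - Real.exp (-b * t) := by linarith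
    rw [div_mul_eq_mul_div, div_le_iff₀ (by positivity)] at this
    linarith
  have hq4 : q ^ 4 < 1 := pow_lt_one₀ hq0.le hq1 (by norm_num)
  calc b / (4 * a * (1 - Real.exp (-b * t))) ≤ b / (b * (1 - q ^ 4)) :=
        div_le_div_of_nonneg_left hb.le (mul_pos hb (by linarith)) hβ
    _ = 1 / (1 - q ^ 4) := by field_simp
    _ ≤ _ := by
        rw [div_le_div_iff₀ (by linarith) (by linarith)]
        have : 0 ≤ (1 - q) * (q * (1 + q + q ^ 2 - q ^ 3)) := by
          have : q ^ 3 ≤ 1 := pow_le_one₀ hq0.le hq1.le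
          have : 0 ≤ q ^ 2 := by positivity
          exact mul_nonneg (by linarith) (mul_nonneg hq0.le (by linarith))
        nlinarith [this]

/-- Along the dynamics, one coordinate contributes `g * x'` to the derivative of the objective and
`w` to the derivative of the kinetic energy; the cross terms in `g` cancel and the remainder is
controlled by `rate_le`. -/
theorem exists_hasDerivAt_kinetic {a b ε t g σ : ℝ} {m v : ℝ → ℝ} (ha : 0 < a) (hb : 0 < b)
    (hab : b ≤ 4 * a) (hε : 0 < ε) (ht : 0 < t) (hσ : 0 ≤ σ) (hv : 0 < v t)
    (hm' : HasDerivAt m (a * (g - m t)) t) (hv' : HasDerivAt v (b * (σ - v t)) t) :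
    ∃ w, HasDerivAt (fun r => m r ^ 2 / (2 * (a * (1 - Real.exp (-a * r)) *
        (ε + Real.sqrt ((1 - Real.exp (-b * r))⁻¹ * v r))))) w t ∧
      g * -((1 - Real.exp (-a * t))⁻¹ * m t /
        (ε + Real.sqrt ((1 - Real.exp (-b * t))⁻¹ * v t))) + w ≤
      -(ε * m t ^ 2 / (ε + Real.sqrt ((1 - Real.exp (-b * t))⁻¹ * v t)) ^ 2) := by
  have hrate := rate_le ha hb hab ht
  have hα' : ∀ c : ℝ, HasDerivAt (fun r => 1 - Real.exp (-c * r)) (c * Real.exp (-c * t)) t := by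
    intro c
    have := (((hasDerivAt_id t).const_mul (-c)).exp).const_sub 1
    refine this.congr_deriv ?_
    simp only [id]; ring
  have hα1 : 1 - Real.exp (-a * t) < 1 := by linarith [Real.exp_pos (-a * t)]
  have hα0 : 0 < 1 - Real.exp (-a * t) := sub_pos.2 (Real.exp_lt_one_iff.2 (by nlinarith))
  have hβ0 : 0 < 1 - Real.exp (-b * t) := sub_pos.2 (Real.exp_lt_one_iff.2 (by nlinarith))
  have hD := (((hα' b).inv hβ0.ne').mul hv').sqrt (by
    simp only [Pi.mul_apply, Pi.inv_apply]; positivity)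
  have hU := (((hα' a).const_mul a).mul (hD.const_add ε)).const_mul 2
  simp only [Pi.mul_apply, Pi.inv_apply] at hD hU
  have hs0 : 0 < Real.sqrt ((1 - Real.exp (-b * t))⁻¹ * v t) := Real.sqrt_pos.2 (by positivity)
  have hsv : v t = (1 - Real.exp (-b * t)) *
      Real.sqrt ((1 - Real.exp (-b * t))⁻¹ * v t) ^ 2 := by
    rw [Real.sq_sqrt (by positivity), mul_inv_cancel_left₀ hβ0.ne']
  have hW := (hm'.pow 2).div hU (by positivity)
  refine ⟨_, hW, ?_⟩
  clear hW hU hD hα' hv' hm'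
  simp only [Pi.pow_apply]
  generalize Real.sqrt ((1 - Real.exp (-b * t))⁻¹ * v t) = s at *
  obtain ⟨α, hα⟩ : ∃ α, Real.exp (-a * t) = 1 - α := ⟨_, (sub_sub_cancel _ _).symm⟩
  obtain ⟨β, hβ⟩ : ∃ β, Real.exp (-b * t) = 1 - β := ⟨_, (sub_sub_cancel _ _).symm⟩
  simp only [hα, hβ, sub_sub_cancel] at *
  generalize m t = μ at *
  rw [hsv]
  have hD0 : 0 < ε + s := by linarith
  have hlow : ε / (ε + s) ≤ (1 + α) / (2 * α) + b * σ / (4 * a * β * s * (ε + s)) -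
      b / (4 * a * β) * (s / (ε + s)) := by
    have h1 : s / (ε + s) = 1 - ε / (ε + s) := by field_simp; ring
    have h2 : 0 ≤ s / (ε + s) := by positivity
    have h3 : 0 ≤ ε / (ε + s) := by positivity
    have h4 : 1 ≤ (1 + α) / (2 * α) := by rw [le_div_iff₀ (by positivity)]; linarith
    have h5 : 0 ≤ b * σ / (4 * a * β * s * (ε + s)) := by positivity
    have h6 := mul_le_mul_of_nonneg_right hrate h2
    have h7 := mul_le_mul_of_nonneg_right h4 h3
    rw [h1] at h6 ⊢
    linarith
  have hμ : μ ^ 2 / (ε + s) ≤ μ ^ 2 / (α * (ε + s)) :=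
    div_le_div_of_nonneg_left (sq_nonneg _) (by positivity) (by nlinarith)
  have hprod : μ ^ 2 / (ε + s) * (ε / (ε + s)) ≤ μ ^ 2 / (α * (ε + s)) *
      ((1 + α) / (2 * α) + b * σ / (4 * a * β * s * (ε + s)) -
        b / (4 * a * β) * (s / (ε + s))) :=
    mul_le_mul hμ hlow (by positivity) (by positivity)
  calc _ = -(μ ^ 2 / (α * (ε + s)) *
      ((1 + α) / (2 * α) + b * σ / (4 * a * β * s * (ε + s)) -
        b / (4 * a * β) * (s / (ε + s)))) := by
        field_simp
        ring
    _ ≤ -(μ ^ 2 / (ε + s) * (ε / (ε + s))) := neg_le_neg hprod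
    _ = _ := by rw [div_mul_div_comm, mul_comm (μ ^ 2) ε, ← sq]

/-! ### The random gradient -/

section Model

variable {d : ℕ} {Ω Ξ : Type*} [MeasurableSpace Ω] [MeasurableSpace Ξ]
  {P : Measure Ω} {ξ : Ω → Ξ} {f : E d → Ξ → ℝ}

theorem Model.hasGradientAt (hf : Model P ξ f) (x : E d) (s : Ξ) :
    HasGradientAt (fun y => f y s) (gradf f x s) x :=
  (hf.differentiable s x).hasGradientAt

/-- Joint measurability: each partial derivative is a pointwise limit of difference quotients. -/
theorem Model.measurable_gradf (hf : Model P ξ f) :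
    Measurable fun p : E d × Ξ => gradf f p.1 p.2 := by
  have hcoord : ∀ i, Measurable fun p : E d × Ξ => gradf f p.1 p.2 i := by
    intro i
    refine measurable_of_tendsto_metrizable (f := fun (n : ℕ) (p : E d × Ξ) =>
      (n : ℝ) • (f (p.1 + (n : ℝ)⁻¹ • EuclideanSpace.single i (1 : ℝ)) p.2 - f p.1 p.2))
      (fun n => ?_) (tendsto_pi_nhds.2 fun p => ?_)
    · have h1 : Measurable fun p : E d × Ξ =>
          (p.1 + (n : ℝ)⁻¹ • EuclideanSpace.single i (1 : ℝ), p.2) :=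
        (measurable_fst.add_const _).prodMk measurable_snd
      exact ((hf.measurable.comp h1).sub hf.measurable).const_smul (n : ℝ)
    · have h := (hf.hasGradientAt p.1 p.2).hasFDerivAt.lim (EuclideanSpace.single i (1 : ℝ))
        (c := fun n : ℕ => (n : ℝ)) (l := atTop)
        (by simpa using tendsto_natCast_atTop_atTop (R := ℝ))
      convert h using 2
      simp [InnerProductSpace.toDual_apply_apply, EuclideanSpace.inner_single_right]
  exact (WithLp.measurable_toLp 2 (Fin d → ℝ)).comp (measurable_pi_iff.2 hcoord)

theorem Model.measurable_gradf_comp (hf : Model P ξ f) (hξ : Measurable ξ) (x : E d) :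
    Measurable fun ω => gradf f x (ξ ω) :=
  hf.measurable_gradf.comp (measurable_const.prodMk hξ)

/-- On a ball the gradient is bounded in `L²` and Lipschitz as a map into `L²`. -/
theorem Model.exists_bound (hf : Model P ξ f) (hξ : Measurable ξ) (R : ℝ) :
    ∃ L B : ℝ, 0 < L ∧ 0 ≤ B ∧ ∀ x ∈ Metric.closedBall (0 : E d) R,
      (Integrable (fun ω => ‖gradf f x (ξ ω)‖ ^ 2) P ∧ ∫ ω, ‖gradf f x (ξ ω)‖ ^ 2 ∂P ≤ B) ∧
      ∀ y ∈ Metric.closedBall (0 : E d) R,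
        Integrable (fun ω => ‖gradf f x (ξ ω) - gradf f y (ξ ω)‖ ^ 2) P ∧
        ∫ ω, ‖gradf f x (ξ ω) - gradf f y (ξ ω)‖ ^ 2 ∂P ≤ L ^ 2 * ‖x - y‖ ^ 2 := by
  obtain ⟨p, -, hp⟩ := hf.exists_integrable
  obtain ⟨L, hL, hLip⟩ := hf.lipschitz (Metric.closedBall (0 : E d) (max R ‖p‖))
    (isCompact_closedBall _ _)
  have hsub : Metric.closedBall (0 : E d) R ⊆ Metric.closedBall 0 (max R ‖p‖) :=
    Metric.closedBall_subset_closedBall (le_max_left _ _)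
  have hpm : p ∈ Metric.closedBall (0 : E d) (max R ‖p‖) := by simp
  refine ⟨L, 2 * (L ^ 2 * (2 * max R ‖p‖) ^ 2) + 2 * ∫ ω, ‖gradf f p (ξ ω)‖ ^ 2 ∂P, hL,
    by positivity, fun x hx => ⟨?_, fun y hy => hLip x (hsub hx) y (hsub hy)⟩⟩
  obtain ⟨h1, h2⟩ := hLip x (hsub hx) p hpm
  have hle : ∀ ω, ‖gradf f x (ξ ω)‖ ^ 2 ≤
      2 * ‖gradf f x (ξ ω) - gradf f p (ξ ω)‖ ^ 2 + 2 * ‖gradf f p (ξ ω)‖ ^ 2 := by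
    intro ω
    have := norm_add_le (gradf f x (ξ ω) - gradf f p (ξ ω)) (gradf f p (ξ ω))
    rw [sub_add_cancel] at this
    nlinarith [norm_nonneg (gradf f x (ξ ω)), sq_nonneg
      (‖gradf f x (ξ ω) - gradf f p (ξ ω)‖ - ‖gradf f p (ξ ω)‖)]
  have hdom := (h1.const_mul 2).add (hp.const_mul 2)
  have hint : Integrable (fun ω => ‖gradf f x (ξ ω)‖ ^ 2) P := by
    refine hdom.mono' ((hf.measurable_gradf_comp hξ x).norm.pow_const 2).aestronglyMeasurable
      (ae_of_all _ fun ω => ?_)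
    rw [Real.norm_of_nonneg (by positivity)]
    exact hle ω
  refine ⟨hint, (integral_mono hint hdom hle).trans ?_⟩
  simp only [Pi.add_apply]
  rw [integral_add (h1.const_mul 2) (hp.const_mul 2), integral_const_mul, integral_const_mul]
  have hxp : ‖x - p‖ ≤ 2 * max R ‖p‖ := by
    have := norm_sub_le x p
    have hx' := hsub hx
    rw [mem_closedBall_zero_iff] at hx' hpm
    linarith
  have : ‖x - p‖ ^ 2 ≤ (2 * max R ‖p‖) ^ 2 := pow_le_pow_left₀ (norm_nonneg _) hxp 2
  have := mul_le_mul_of_nonneg_left this (sq_nonneg L)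
  linarith

theorem Model.integrable_norm_gradf_sq (hf : Model P ξ f) (hξ : Measurable ξ) (x : E d) :
    Integrable (fun ω => ‖gradf f x (ξ ω)‖ ^ 2) P := by
  obtain ⟨L, B, -, -, h⟩ := hf.exists_bound hξ ‖x‖
  exact (h x (by simp)).1.1

theorem Model.exists_lipschitz_secondMoment (hf : Model P ξ f) (hξ : Measurable ξ) (R : ℝ) :
    ∃ C, 0 ≤ C ∧ ∀ x ∈ Metric.closedBall (0 : E d) R, ∀ y ∈ Metric.closedBall (0 : E d) R,
      ∀ i, |secondMoment P ξ f x i - secondMoment P ξ f y i| ≤ C * ‖x - y‖ := by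
  obtain ⟨L, B, hL, hB, hb⟩ := hf.exists_bound hξ R
  refine ⟨L ^ 2 * (2 * |R| + 1) + B, by positivity, fun x hx y hy i => ?_⟩
  rcases eq_or_ne x y with rfl | hxy
  · simp
  have hδ : 0 < ‖x - y‖ := norm_pos_iff.2 (sub_ne_zero.2 hxy)
  obtain ⟨h1, h2⟩ := (hb x hx).2 y hy
  obtain ⟨h3, h4⟩ := (hb y hy).1
  have hsq : ∀ w : E d, Integrable (fun ω => gradf f w (ξ ω) i ^ 2) P := by
    intro w
    refine (hf.integrable_norm_gradf_sq hξ w).mono' ?_ (ae_of_all _ fun ω => ?_)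
    · exact (((EuclideanSpace.proj (𝕜 := ℝ) i).continuous.measurable.comp
        (hf.measurable_gradf_comp hξ w)).pow_const 2).aestronglyMeasurable
    · rw [norm_pow]
      exact pow_le_pow_left₀ (norm_nonneg _) (PiLp.norm_apply_le _ i) 2
  have hdom := (h1.const_mul (1 + ‖x - y‖⁻¹)).add (h3.const_mul ‖x - y‖)
  -- `|p² - q²| ≤ |p - q|² + 2 |q| |p - q|`, and the last term is split with weight `‖x - y‖`
  have hle : ∀ ω, ‖gradf f x (ξ ω) i ^ 2 - gradf f y (ξ ω) i ^ 2‖ ≤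
      (1 + ‖x - y‖⁻¹) * ‖gradf f x (ξ ω) - gradf f y (ξ ω)‖ ^ 2 +
        ‖x - y‖ * ‖gradf f y (ξ ω)‖ ^ 2 := by
    intro ω
    have hD : |gradf f x (ξ ω) i - gradf f y (ξ ω) i| ≤ ‖gradf f x (ξ ω) - gradf f y (ξ ω)‖ :=
      PiLp.norm_apply_le (gradf f x (ξ ω) - gradf f y (ξ ω)) i
    have hQ : |gradf f y (ξ ω) i| ≤ ‖gradf f y (ξ ω)‖ :=
      PiLp.norm_apply_le (gradf f y (ξ ω)) i
    generalize gradf f x (ξ ω) i = p at *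
    generalize gradf f y (ξ ω) i = q at *
    generalize ‖gradf f x (ξ ω) - gradf f y (ξ ω)‖ = D at *
    generalize ‖gradf f y (ξ ω)‖ = Q at *
    generalize ‖x - y‖ = δ at *
    have hfac : |p ^ 2 - q ^ 2| ≤ D * (D + 2 * Q) := by
      rw [show p ^ 2 - q ^ 2 = (p - q) * ((p - q) + 2 * q) by ring, abs_mul]
      refine mul_le_mul hD ((abs_add_le _ _).trans ?_) (abs_nonneg _) ((abs_nonneg _).trans hD)
      rw [abs_mul, abs_two]
      linarith
    have h5 : 0 ≤ δ⁻¹ * (D - δ * Q) ^ 2 := by positivity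
    have h6 : δ⁻¹ * (D - δ * Q) ^ 2 = δ⁻¹ * D ^ 2 + δ * Q ^ 2 - 2 * (D * Q) := by
      field_simp; ring
    rw [Real.norm_eq_abs]
    nlinarith
  have hdist : ‖x - y‖ ≤ 2 * |R| := by
    rw [mem_closedBall_zero_iff] at hx hy
    linarith [norm_sub_le x y, le_abs_self R]
  calc |secondMoment P ξ f x i - secondMoment P ξ f y i|
      = ‖∫ ω, (gradf f x (ξ ω) i ^ 2 - gradf f y (ξ ω) i ^ 2) ∂P‖ := by
        rw [integral_sub (hsq x) (hsq y)]; rfl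
    _ ≤ ∫ ω, ((1 + ‖x - y‖⁻¹) * ‖gradf f x (ξ ω) - gradf f y (ξ ω)‖ ^ 2 +
        ‖x - y‖ * ‖gradf f y (ξ ω)‖ ^ 2) ∂P :=
        norm_integral_le_of_norm_le hdom (ae_of_all _ hle)
    _ = (1 + ‖x - y‖⁻¹) * ∫ ω, ‖gradf f x (ξ ω) - gradf f y (ξ ω)‖ ^ 2 ∂P +
        ‖x - y‖ * ∫ ω, ‖gradf f y (ξ ω)‖ ^ 2 ∂P := by
        rw [integral_add (h1.const_mul _) (h3.const_mul _), integral_const_mul, integral_const_mul]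
    _ ≤ (1 + ‖x - y‖⁻¹) * (L ^ 2 * ‖x - y‖ ^ 2) + ‖x - y‖ * B := by gcongr
    _ = (L ^ 2 * (‖x - y‖ + 1) + B) * ‖x - y‖ := by field_simp
    _ ≤ (L ^ 2 * (2 * |R| + 1) + B) * ‖x - y‖ := by gcongr

/-- The first-order Taylor remainder as an integral along the segment, for almost every sample. -/
theorem Model.ae_remainder_eq (hf : Model P ξ f) (x h : E d) :
    ∀ᵐ ω ∂P, f (x + h) (ξ ω) - f x (ξ ω) - inner ℝ (gradf f x (ξ ω)) h =
      ∫ τ in (0 : ℝ)..1, inner ℝ (gradf f (x + τ • h) (ξ ω) - gradf f x (ξ ω)) h := by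
  filter_upwards [hf.contDiff] with ω hω
  have hd : ∀ τ : ℝ, HasDerivAt
      (fun τ : ℝ => f (x + τ • h) (ξ ω) - τ * inner ℝ (gradf f x (ξ ω)) h)
      (inner ℝ (gradf f (x + τ • h) (ξ ω) - gradf f x (ξ ω)) h) τ := by
    intro τ
    have h1 : HasDerivAt (fun τ : ℝ => x + τ • h) h τ := by
      simpa using ((hasDerivAt_id τ).smul_const h).const_add x
    have h2 := (hf.hasGradientAt (x + τ • h) (ξ ω)).hasFDerivAt.comp_hasDerivAt τ h1
    have h3 := h2.sub ((hasDerivAt_id τ).mul_const (inner ℝ (gradf f x (ξ ω)) h))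
    refine h3.congr_deriv ?_
    simp [InnerProductSpace.toDual_apply_apply, inner_sub_left]
  have hcont : Continuous fun y => gradf f y (ξ ω) :=
    (InnerProductSpace.toDual ℝ (E d)).symm.continuous.comp (hω.continuous_fderiv (by norm_num))
  rw [intervalIntegral.integral_eq_sub_of_hasDerivAt (fun τ _ => hd τ)]
  · simp; ring
  · refine Continuous.intervalIntegrable ?_ _ _
    have : Continuous fun τ : ℝ => gradf f (x + τ • h) (ξ ω) :=
      hcont.comp (by fun_prop)
    fun_prop

theorem Model.aestronglyMeasurable_remainder (hf : Model P ξ f) (hξ : Measurable ξ) (x h : E d) :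
    AEStronglyMeasurable
      (fun ω => f (x + h) (ξ ω) - f x (ξ ω) - inner ℝ (gradf f x (ξ ω)) h) P := by
  have h1 : ∀ y : E d, Measurable fun ω => f y (ξ ω) :=
    fun y => hf.measurable.comp (measurable_const.prodMk hξ)
  exact (((h1 _).sub (h1 _)).sub
    ((hf.measurable_gradf_comp hξ x).inner measurable_const)).aestronglyMeasurable

variable [IsProbabilityMeasure P]

theorem Model.integrable_gradf (hf : Model P ξ f) (hξ : Measurable ξ) (x : E d) :
    Integrable (fun ω => gradf f x (ξ ω)) P :=
  ((memLp_two_iff_integrable_sq_norm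
    (hf.measurable_gradf_comp hξ x).aestronglyMeasurable).2
      (hf.integrable_norm_gradf_sq hξ x)).integrable (by norm_num)

/-- Quadratic bound on the mean Taylor remainder. The hypotheses control the gradient only in `L²`,
point by point, so that no integrable domination is available and Tonelli's theorem on
`[0, 1] × Ω` replaces differentiation under the integral sign. -/
theorem Model.lintegral_remainder_le (hf : Model P ξ f) (hξ : Measurable ξ) {L R : ℝ} (hL : 0 < L)
    (hLip : ∀ x ∈ Metric.closedBall (0 : E d) R, ∀ y ∈ Metric.closedBall (0 : E d) R,
        Integrable (fun ω => ‖gradf f x (ξ ω) - gradf f y (ξ ω)‖ ^ 2) P ∧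
        ∫ ω, ‖gradf f x (ξ ω) - gradf f y (ξ ω)‖ ^ 2 ∂P ≤ L ^ 2 * ‖x - y‖ ^ 2)
    {x h : E d} (hx : x ∈ Metric.closedBall (0 : E d) R)
    (hxh : x + h ∈ Metric.closedBall (0 : E d) R) :
    ∫⁻ ω, ‖f (x + h) (ξ ω) - f x (ξ ω) - inner ℝ (gradf f x (ξ ω)) h‖ₑ ∂P ≤
      ENNReal.ofReal (L * ‖h‖ ^ 2) := by
  have hmeas : Measurable fun p : Ω × ℝ =>
      inner ℝ (gradf f (x + p.2 • h) (ξ p.1) - gradf f x (ξ p.1)) h := by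
    have h1 : Measurable fun p : Ω × ℝ => gradf f (x + p.2 • h) (ξ p.1) := by
      refine hf.measurable_gradf.comp (Measurable.prodMk ?_ (hξ.comp measurable_fst))
      exact (measurable_snd.smul_const h).const_add x
    have h2 : Measurable fun p : Ω × ℝ => gradf f x (ξ p.1) :=
      (hf.measurable_gradf_comp hξ x).comp measurable_fst
    exact (h1.sub h2).inner measurable_const
  calc ∫⁻ ω, ‖f (x + h) (ξ ω) - f x (ξ ω) - inner ℝ (gradf f x (ξ ω)) h‖ₑ ∂P
      ≤ ∫⁻ ω, (∫⁻ τ in Set.Ioc (0 : ℝ) 1,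
          ‖(inner ℝ (gradf f (x + τ • h) (ξ ω) - gradf f x (ξ ω)) h : ℝ)‖ₑ) ∂P := by
        refine lintegral_mono_ae ?_
        filter_upwards [hf.ae_remainder_eq x h] with ω hω
        rw [hω, intervalIntegral.integral_of_le zero_le_one]
        exact enorm_integral_le_lintegral_enorm _
    _ = ∫⁻ τ in Set.Ioc (0 : ℝ) 1, ∫⁻ ω,
          ‖(inner ℝ (gradf f (x + τ • h) (ξ ω) - gradf f x (ξ ω)) h : ℝ)‖ₑ ∂P :=
        lintegral_lintegral_swap hmeas.enorm.aemeasurable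
    _ ≤ ∫⁻ τ in Set.Ioc (0 : ℝ) 1, ENNReal.ofReal (L * ‖h‖ ^ 2) := by
        refine setLIntegral_mono measurable_const fun τ hτ => ?_
        have hmem : x + τ • h ∈ Metric.closedBall (0 : E d) R := by
          have := (convex_closedBall (0 : E d) R).add_smul_sub_mem hx hxh ⟨hτ.1.le, hτ.2⟩
          simpa using this
        obtain ⟨h1, h2⟩ := hLip _ hmem x hx
        -- `‖D‖ ‖h‖ ≤ (L ‖h‖² + L⁻¹ ‖D‖²) / 2` trades the first moment for the second
        have hint : Integrable (fun ω => (L * ‖h‖ ^ 2 +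
            L⁻¹ * ‖gradf f (x + τ • h) (ξ ω) - gradf f x (ξ ω)‖ ^ 2) / 2) P :=
          ((integrable_const _).add (h1.const_mul _)).div_const 2
        calc ∫⁻ ω, ‖(inner ℝ (gradf f (x + τ • h) (ξ ω) - gradf f x (ξ ω)) h : ℝ)‖ₑ ∂P
            ≤ ∫⁻ ω, ENNReal.ofReal ((L * ‖h‖ ^ 2 +
              L⁻¹ * ‖gradf f (x + τ • h) (ξ ω) - gradf f x (ξ ω)‖ ^ 2) / 2) ∂P := by
              refine lintegral_mono fun ω => ?_
              rw [← ofReal_norm]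
              refine ENNReal.ofReal_le_ofReal ((norm_inner_le_norm _ _).trans ?_)
              set D := ‖gradf f (x + τ • h) (ξ ω) - gradf f x (ξ ω)‖
              have h3 : 0 ≤ L⁻¹ * (L * ‖h‖ - D) ^ 2 := by positivity
              have h4 : L⁻¹ * (L * ‖h‖ - D) ^ 2 = L * ‖h‖ ^ 2 + L⁻¹ * D ^ 2 - 2 * (D * ‖h‖) := by
                field_simp; ring
              linarith
          _ = ENNReal.ofReal (∫ ω, (L * ‖h‖ ^ 2 +
              L⁻¹ * ‖gradf f (x + τ • h) (ξ ω) - gradf f x (ξ ω)‖ ^ 2) / 2 ∂P) :=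
              (ofReal_integral_eq_lintegral_ofReal hint
                (ae_of_all _ fun ω => by simp only [Pi.zero_apply]; positivity)).symm
          _ ≤ ENNReal.ofReal (L * ‖h‖ ^ 2) := by
              refine ENNReal.ofReal_le_ofReal ?_
              rw [integral_div, integral_add (integrable_const _) (h1.const_mul _),
                integral_const, probReal_univ, one_smul, integral_const_mul]
              rw [add_sub_cancel_left, norm_smul, Real.norm_of_nonneg hτ.1.le] at h2
              have h3 : (τ * ‖h‖) ^ 2 ≤ ‖h‖ ^ 2 :=
                pow_le_pow_left₀ (mul_nonneg hτ.1.le (norm_nonneg _))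
                  (mul_le_of_le_one_left (norm_nonneg _) hτ.2) 2
              have h4 : L⁻¹ * ∫ ω, ‖gradf f (x + τ • h) (ξ ω) - gradf f x (ξ ω)‖ ^ 2 ∂P ≤
                  L * ‖h‖ ^ 2 := by
                rw [inv_mul_le_iff₀ hL]
                nlinarith [sq_nonneg L]
              linarith
    _ = ENNReal.ofReal (L * ‖h‖ ^ 2) := by simp

theorem Model.integrable_remainder (hf : Model P ξ f) (hξ : Measurable ξ) (x h : E d) :
    Integrable (fun ω => f (x + h) (ξ ω) - f x (ξ ω) - inner ℝ (gradf f x (ξ ω)) h) P := by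
  obtain ⟨L, B, hL, -, hb⟩ := hf.exists_bound hξ (max ‖x‖ ‖x + h‖)
  refine ⟨hf.aestronglyMeasurable_remainder hξ x h, ?_⟩
  exact (hf.lintegral_remainder_le hξ hL (fun x hx y hy => (hb x hx).2 y hy)
    (by simp) (by simp)).trans_lt ENNReal.ofReal_lt_top

/-- Integrability at one point spreads to all points through the Taylor expansion. -/
theorem Model.integrable (hf : Model P ξ f) (hξ : Measurable ξ) (x : E d) :
    Integrable (fun ω => f x (ξ ω)) P := by
  obtain ⟨p, hp, -⟩ := hf.exists_integrable
  have h := ((hf.integrable_remainder hξ p (x - p)).add hp).add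
    ((hf.integrable_gradf hξ p).inner_const (x - p))
  refine h.congr (ae_of_all _ fun ω => ?_)
  simp only [Pi.add_apply, add_sub_cancel]
  ring

/-! ### Regularity of the objective -/

/-- The expectation commutes with the gradient, since the mean Taylor remainder is quadratic. -/
theorem Model.hasGradientAt_objective (hf : Model P ξ f) (hξ : Measurable ξ) (x : E d) :
    HasGradientAt (objective P ξ f) (∫ ω, gradf f x (ξ ω) ∂P) x := by
  obtain ⟨L, B, hL, -, hb⟩ := hf.exists_bound hξ (‖x‖ + 1)
  rw [hasGradientAt_iff_isLittleO]
  have hO : (fun y => objective P ξ f y - objective P ξ f x -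
      inner ℝ (∫ ω, gradf f x (ξ ω) ∂P) (y - x)) =O[𝓝 x] fun y => ‖y - x‖ ^ 2 := by
    refine Asymptotics.IsBigO.of_bound L ?_
    filter_upwards [Metric.closedBall_mem_nhds x one_pos] with y hy
    have hy' : y ∈ Metric.closedBall (0 : E d) (‖x‖ + 1) := by
      rw [mem_closedBall_iff_norm] at hy
      rw [mem_closedBall_zero_iff]
      linarith [norm_le_norm_add_norm_sub' y x]
    have hrem : objective P ξ f y - objective P ξ f x -
        inner ℝ (∫ ω, gradf f x (ξ ω) ∂P) (y - x) =
        ∫ ω, (f (x + (y - x)) (ξ ω) - f x (ξ ω) - inner ℝ (gradf f x (ξ ω)) (y - x)) ∂P := by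
      have hy0 := hf.integrable hξ (x + (y - x))
      rw [integral_sub (f := fun ω => f (x + (y - x)) (ξ ω) - f x (ξ ω))
        (hy0.sub (hf.integrable hξ x)) ((hf.integrable_gradf hξ x).inner_const (y - x)), integral_sub hy0 (hf.integrable hξ x)]
      simp_rw [real_inner_comm (y - x)]
      rw [integral_inner (hf.integrable_gradf hξ x), add_sub_cancel]
      rfl
    rw [hrem, norm_pow, norm_norm, ← ENNReal.ofReal_le_ofReal_iff (by positivity), ofReal_norm]
    exact (enorm_integral_le_lintegral_enorm _).trans
      (hf.lintegral_remainder_le hξ hL (fun x hx y hy => (hb x hx).2 y hy)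
        (by simp) (by simpa using hy'))
  refine hO.trans_isLittleO ?_
  have h1 : Tendsto (fun y : E d => ‖y - x‖) (𝓝 x) (𝓝 0) := by
    simpa using (tendsto_id (x := 𝓝 x)).sub_const x |>.norm
  exact ((Asymptotics.isLittleO_pow_id (𝕜 := ℝ) one_lt_two).comp_tendsto h1).of_norm_right

theorem Model.gradient_objective (hf : Model P ξ f) (hξ : Measurable ξ) (x : E d) :
    gradient (objective P ξ f) x = ∫ ω, gradf f x (ξ ω) ∂P :=
  (hf.hasGradientAt_objective hξ x).gradient

theorem Model.hasGradientAt_gradient (hf : Model P ξ f) (hξ : Measurable ξ) (x : E d) :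
    HasGradientAt (objective P ξ f) (gradient (objective P ξ f) x) x :=
  (hf.hasGradientAt_objective hξ x).differentiableAt.hasGradientAt

theorem Model.exists_lipschitz_gradient (hf : Model P ξ f) (hξ : Measurable ξ) (R : ℝ) :
    ∃ C, 0 ≤ C ∧ ∀ x ∈ Metric.closedBall (0 : E d) R, ∀ y ∈ Metric.closedBall (0 : E d) R,
      ‖gradient (objective P ξ f) x - gradient (objective P ξ f) y‖ ≤ C * ‖x - y‖ := by
  obtain ⟨L, B, hL, -, hb⟩ := hf.exists_bound hξ R
  refine ⟨L, hL.le, fun x hx y hy => ?_⟩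
  obtain ⟨h1, h2⟩ := (hb x hx).2 y hy
  have hi := (hf.integrable_gradf hξ x).sub (hf.integrable_gradf hξ y)
  rw [hf.gradient_objective hξ, hf.gradient_objective hξ,
    ← integral_sub (hf.integrable_gradf hξ x) (hf.integrable_gradf hξ y)]
  refine (norm_integral_le_integral_norm _).trans ?_
  -- Jensen's inequality
  have hj : (∫ ω, ‖gradf f x (ξ ω) - gradf f y (ξ ω)‖ ∂P) ^ 2 ≤
      ∫ ω, ‖gradf f x (ξ ω) - gradf f y (ξ ω)‖ ^ 2 ∂P :=
    (even_two.convexOn_pow (𝕜 := ℝ)).map_integral_le (continuous_pow 2).continuousOn isClosed_univ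
      (ae_of_all _ fun _ => Set.mem_univ _) hi.norm h1
  refine le_of_sq_le_sq ?_ (by positivity)
  rw [mul_pow]
  exact hj.trans h2

end Model

/-! ### The Lyapunov function -/

theorem norm_le_mul_norm_of_coord {d : ℕ} {x y : E d} {A : ℝ} (hA : 0 ≤ A)
    (h : ∀ i, |y i| ≤ A * |x i|) : ‖y‖ ≤ A * ‖x‖ := by
  rw [← Real.norm_of_nonneg hA, ← norm_smul]
  refine le_of_sq_le_sq ?_ (norm_nonneg _)
  rw [EuclideanSpace.norm_sq_eq, EuclideanSpace.norm_sq_eq]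
  refine Finset.sum_le_sum fun i _ => pow_le_pow_left₀ (norm_nonneg _) ?_ 2
  simpa [abs_of_nonneg hA] using h i

theorem tendsto_zero_of_coord {d : ℕ} {u : ℝ → E d}
    (h : ∀ i, Tendsto (fun t => u t i) atTop (𝓝 0)) : Tendsto u atTop (𝓝 0) := by
  have := ((PiLp.continuous_toLp 2 (fun _ : Fin d => ℝ)).tendsto 0).comp (tendsto_pi_nhds.2 h)
  rwa [WithLp.toLp_zero] at this

/-- The Lyapunov function: the objective plus the kinetic energy of the momentum `m`, measured with
the time-dependent weights `a (1 - exp (-a t)) (ε + √(v / (1 - exp (-b t))))`. -/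
noncomputable def energy {d : ℕ} (a b ε : ℝ) (F : E d → ℝ) (t : ℝ) (z : Z d) : ℝ :=
  F z.1 + ∑ i, z.2.1 i ^ 2 / (2 * (a * (1 - Real.exp (-a * t)) *
    (ε + Real.sqrt ((1 - Real.exp (-b * t))⁻¹ * z.2.2 i))))

section Dynamics

variable {d : ℕ} {a b ε : ℝ} {F : E d → ℝ} {S : E d → E d} {x₀ : E d} {z : ℝ → Z d}

theorem IsGlobalSolution.hasDerivAt_x (hz : IsGlobalSolution a b ε F S x₀ z) {t : ℝ} (ht : 0 < t) :
    HasDerivAt (fun r => (z r).1) (field a b ε F S t (z t)).1 t :=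
  (ContinuousLinearMap.fst ℝ (E d) (E d × E d)).hasFDerivAt.comp_hasDerivAt t (hz.ode t ht)

theorem IsGlobalSolution.hasDerivAt_m (hz : IsGlobalSolution a b ε F S x₀ z) {t : ℝ} (ht : 0 < t)
    (i : Fin d) :
    HasDerivAt (fun r => (z r).2.1 i) (a * (gradient F (z t).1 i - (z t).2.1 i)) t :=
  ((EuclideanSpace.proj (𝕜 := ℝ) i).comp ((ContinuousLinearMap.fst ℝ (E d) (E d)).comp
    (ContinuousLinearMap.snd ℝ (E d) (E d × E d)))).hasFDerivAt.comp_hasDerivAt t (hz.ode t ht)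

theorem IsGlobalSolution.hasDerivAt_v (hz : IsGlobalSolution a b ε F S x₀ z) {t : ℝ} (ht : 0 < t)
    (i : Fin d) :
    HasDerivAt (fun r => (z r).2.2 i) (b * (S (z t).1 i - (z t).2.2 i)) t :=
  ((EuclideanSpace.proj (𝕜 := ℝ) i).comp ((ContinuousLinearMap.snd ℝ (E d) (E d)).comp
    (ContinuousLinearMap.snd ℝ (E d) (E d × E d)))).hasFDerivAt.comp_hasDerivAt t (hz.ode t ht)

/-- Positivity of `v` at positive times makes `√v` differentiable along the solution; it holds
because `exp (b t) v i` starts from `0` and is strictly increasing. -/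
theorem IsGlobalSolution.v_pos (hz : IsGlobalSolution a b ε F S x₀ z) (hb : 0 < b)
    (hS : ∀ x i, 0 < S x i) {t : ℝ} (ht : 0 < t) (i : Fin d) : 0 < (z t).2.2 i := by
  have hmono : StrictMonoOn (fun r => Real.exp (b * r) * (z r).2.2 i) (Set.Ici 0) := by
    refine strictMonoOn_of_deriv_pos (convex_Ici 0) ?_ fun r hr => ?_
    · have h1 : ContinuousOn (fun r => (z r).2.2 i) (Set.Ici 0) :=
        (EuclideanSpace.proj (𝕜 := ℝ) i).continuous.comp_continuousOn
          (continuous_snd.comp_continuousOn (continuous_snd.comp_continuousOn hz.continuousOn))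
      exact (Continuous.continuousOn (by fun_prop)).mul h1
    · rw [interior_Ici] at hr
      have h1 : HasDerivAt (fun r => Real.exp (b * r)) (Real.exp (b * r) * b) r := by
        simpa using ((hasDerivAt_id r).const_mul b).exp
      have h2 : HasDerivAt (fun r => Real.exp (b * r) * (z r).2.2 i)
          (Real.exp (b * r) * b * S (z r).1 i) r :=
        (h1.mul (hz.hasDerivAt_v hr i)).congr_deriv (by ring)
      rw [h2.deriv]
      have := hS (z r).1 i
      positivity
  have h := hmono Set.self_mem_Ici ht.le ht
  simp only [hz.init, PiLp.zero_apply, mul_zero] at h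
  exact pos_of_mul_pos_right h (Real.exp_pos _).le

/-- Dissipation of energy: the terms of `exists_hasDerivAt_kinetic` summed over the coordinates. -/
theorem IsGlobalSolution.exists_hasDerivAt_energy (hz : IsGlobalSolution a b ε F S x₀ z)
    (ha : 0 < a) (hb : 0 < b) (hab : b ≤ 4 * a) (hε : 0 < ε)
    (hF : ∀ x, HasGradientAt F (gradient F x) x) (hS : ∀ x i, 0 < S x i) {t : ℝ} (ht : 0 < t) :
    ∃ w, HasDerivAt (fun r => energy a b ε F r (z r)) w t ∧
      w ≤ -∑ i, ε * (z t).2.1 i ^ 2 /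
        (ε + Real.sqrt ((1 - Real.exp (-b * t))⁻¹ * (z t).2.2 i)) ^ 2 := by
  choose w hw hle using fun i => exists_hasDerivAt_kinetic ha hb hab hε ht (hS (z t).1 i).le
    (hz.v_pos hb hS ht i) (hz.hasDerivAt_m ht i) (hz.hasDerivAt_v ht i)
  have h1 := (hF (z t).1).hasFDerivAt.comp_hasDerivAt t (hz.hasDerivAt_x ht)
  refine ⟨_, h1.add (HasDerivAt.fun_sum fun i _ => hw i), ?_⟩
  rw [InnerProductSpace.toDual_apply_apply, PiLp.inner_apply, ← Finset.sum_add_distrib,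
    ← Finset.sum_neg_distrib]
  refine Finset.sum_le_sum fun i _ => ?_
  simpa [field, mul_comm] using hle i

theorem le_energy (ha : 0 < a) (hε : 0 < ε) {t : ℝ} (ht : 0 < t) (y : Z d) :
    F y.1 ≤ energy a b ε F t y := by
  refine le_add_of_nonneg_right (Finset.sum_nonneg fun i _ => ?_)
  have : 0 < 1 - Real.exp (-a * t) := sub_pos.2 (Real.exp_lt_one_iff.2 (by nlinarith))
  positivity

theorem IsGlobalSolution.energy_antitoneOn (hz : IsGlobalSolution a b ε F S x₀ z)
    (ha : 0 < a) (hb : 0 < b) (hab : b ≤ 4 * a) (hε : 0 < ε)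
    (hF : ∀ x, HasGradientAt F (gradient F x) x) (hS : ∀ x i, 0 < S x i) :
    AntitoneOn (fun r => energy a b ε F r (z r)) (Set.Ioi 0) := by
  choose! w hw hle using fun t ht => hz.exists_hasDerivAt_energy ha hb hab hε hF hS (t := t) ht
  refine antitoneOn_of_deriv_nonpos (convex_Ioi 0)
    (fun t ht => (hw t ht).continuousAt.continuousWithinAt)
    (fun t ht => (hw t (interior_subset ht)).differentiableAt.differentiableWithinAt)
    (fun t ht => ?_)
  rw [(hw t (interior_subset ht)).deriv]
  exact (hle t (interior_subset ht)).trans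
    (neg_nonpos.2 (Finset.sum_nonneg fun i _ => by positivity))

/-! ### Boundedness -/

theorem Coercive.exists_forall_le {F : E d → ℝ} (hco : Coercive F)
    (hF : ∀ x, HasGradientAt F (gradient F x) x) : ∃ p, ∀ y, F p ≤ F y := by
  have hcont : Continuous F := continuous_iff_continuousAt.2 fun x => (hF x).continuousAt
  refine hcont.exists_forall_le ?_
  rw [← Metric.cobounded_eq_cocompact, ← comap_norm_atTop]
  exact hco

theorem Coercive.exists_bound {F : E d → ℝ} (hco : Coercive F) (C : ℝ) :
    ∃ R, 0 ≤ R ∧ ∀ x, F x ≤ C → ‖x‖ ≤ R := by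
  obtain ⟨s, hs, hsub⟩ := mem_comap.1 (hco (Ioi_mem_atTop C))
  obtain ⟨R, hR⟩ := mem_atTop_sets.1 hs
  refine ⟨max R 0, le_max_right _ _, fun x hx => ?_⟩
  by_contra! h
  exact (hsub (hR _ ((le_max_left _ _).trans h.le))).not_ge hx

/-- The energy traps the position in a sublevel set of `F`. -/
theorem IsGlobalSolution.exists_x_bound (hz : IsGlobalSolution a b ε F S x₀ z)
    (ha : 0 < a) (hb : 0 < b) (hab : b ≤ 4 * a) (hε : 0 < ε)
    (hF : ∀ x, HasGradientAt F (gradient F x) x) (hS : ∀ x i, 0 < S x i) (hco : Coercive F) :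
    ∃ R, 0 ≤ R ∧ ∀ t, 1 ≤ t → (z t).1 ∈ Metric.closedBall (0 : E d) R := by
  obtain ⟨R, hR0, hR⟩ := hco.exists_bound (energy a b ε F 1 (z 1))
  refine ⟨R, hR0, fun t ht => mem_closedBall_zero_iff.2 (hR _ ?_)⟩
  have ht0 : 0 < t := by linarith
  exact (le_energy ha hε ht0 (z t)).trans
    (hz.energy_antitoneOn ha hb hab hε hF hS (Set.mem_Ioi.2 one_pos) ht0 ht)

/-- Bounds valid for all times `t ≥ 1`: the position stays in a ball of radius `R`, the gradient and
the second moment at the position and both averages stay bounded by `M`. -/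
structure IsBounded (F : E d → ℝ) (S : E d → E d) (z : ℝ → Z d) (R M : ℝ) : Prop where
  x_mem : ∀ t, 1 ≤ t → (z t).1 ∈ Metric.closedBall (0 : E d) R
  gradient_le : ∀ t, 1 ≤ t → ∀ i, |gradient F (z t).1 i| ≤ M
  S_le : ∀ t, 1 ≤ t → ∀ i, |S (z t).1 i| ≤ M
  m_le : ∀ t, 1 ≤ t → ∀ i, |(z t).2.1 i| ≤ M
  v_le : ∀ t, 1 ≤ t → ∀ i, |(z t).2.2 i| ≤ M

theorem IsGlobalSolution.exists_isBounded (hz : IsGlobalSolution a b ε F S x₀ z)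
    (ha : 0 < a) (hb : 0 < b) (hab : b ≤ 4 * a) (hε : 0 < ε)
    (hF : ∀ x, HasGradientAt F (gradient F x) x) (hS : ∀ x i, 0 < S x i) (hco : Coercive F)
    (hGL : ∀ R, ∃ C, 0 ≤ C ∧ ∀ x ∈ Metric.closedBall (0 : E d) R,
      ∀ y ∈ Metric.closedBall (0 : E d) R, ‖gradient F x - gradient F y‖ ≤ C * ‖x - y‖)
    (hSL : ∀ R, ∃ C, 0 ≤ C ∧ ∀ x ∈ Metric.closedBall (0 : E d) R,
      ∀ y ∈ Metric.closedBall (0 : E d) R, ∀ i, |S x i - S y i| ≤ C * ‖x - y‖) :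
    ∃ R M, IsBounded F S z R M := by
  obtain ⟨R, hR0, hR⟩ := hz.exists_x_bound ha hb hab hε hF hS hco
  have h0 : (0 : E d) ∈ Metric.closedBall (0 : E d) R := Metric.mem_closedBall_self hR0
  obtain ⟨C₁, hC₁, h₁⟩ := hGL R
  obtain ⟨C₂, hC₂, h₂⟩ := hSL R
  have hG : ∀ t, 1 ≤ t → ∀ i, |gradient F (z t).1 i| ≤ C₁ * R + ‖gradient F 0‖ := by
    intro t ht i
    have h3 := h₁ _ (hR t ht) 0 h0
    have h4 := hR t ht
    rw [mem_closedBall_zero_iff] at h4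
    rw [sub_zero] at h3
    have h5 : |gradient F (z t).1 i| ≤ ‖gradient F (z t).1‖ :=
      PiLp.norm_apply_le (gradient F (z t).1) i
    have h6 := norm_le_norm_add_norm_sub' (gradient F (z t).1) (gradient F 0)
    nlinarith
  have hSb : ∀ t, 1 ≤ t → ∀ i, |S (z t).1 i| ≤ C₂ * R + ‖S 0‖ := by
    intro t ht i
    have h3 := h₂ _ (hR t ht) 0 h0 i
    have h4 := hR t ht
    rw [mem_closedBall_zero_iff] at h4
    rw [sub_zero] at h3
    have h5 : |S 0 i| ≤ ‖S 0‖ := PiLp.norm_apply_le (S 0) i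
    have h6 := abs_sub_abs_le_abs_sub (S (z t).1 i) (S 0 i)
    nlinarith
  have hm : ∀ t, 1 ≤ t → ∀ i, |(z t).2.1 i| ≤ C₁ * R + ‖gradient F 0‖ + ‖(z 1).2.1‖ := by
    intro t ht i
    refine (relaxation_abs_le ha (fun r hr => hz.hasDerivAt_m (one_pos.trans_le hr) i)
      (fun r hr => hG r hr i) t ht).trans ?_
    gcongr
    exact PiLp.norm_apply_le (z 1).2.1 i
  have hv : ∀ t, 1 ≤ t → ∀ i, |(z t).2.2 i| ≤ C₂ * R + ‖S 0‖ + ‖(z 1).2.2‖ := by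
    intro t ht i
    refine (relaxation_abs_le hb (fun r hr => hz.hasDerivAt_v (one_pos.trans_le hr) i)
      (fun r hr => hSb r hr i) t ht).trans ?_
    gcongr
    exact PiLp.norm_apply_le (z 1).2.2 i
  have hp₁ : 0 ≤ C₁ * R + ‖gradient F 0‖ := by positivity
  have hp₂ : 0 ≤ C₂ * R + ‖S 0‖ := by positivity
  refine ⟨R, (C₁ * R + ‖gradient F 0‖ + ‖(z 1).2.1‖) + (C₂ * R + ‖S 0‖ + ‖(z 1).2.2‖), hR,
    fun t ht i => (hG t ht i).trans ?_, fun t ht i => (hSb t ht i).trans ?_,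
    fun t ht i => (hm t ht i).trans ?_, fun t ht i => (hv t ht i).trans ?_⟩ <;>
  linarith [norm_nonneg (z 1).2.1, norm_nonneg (z 1).2.2]

/-- On a time interval after `t = 1` the position moves at a speed controlled by the momentum. -/
theorem IsGlobalSolution.norm_x_sub_le (hz : IsGlobalSolution a b ε F S x₀ z) (ha : 0 < a)
    (hε : 0 < ε) {s t M : ℝ} (hs : 1 ≤ s) (hst : s ≤ t)
    (hM : ∀ r ∈ Set.Icc s t, ‖(z r).2.1‖ ≤ M) :
    ‖(z t).1 - (z s).1‖ ≤ (1 - Real.exp (-a))⁻¹ / ε * M * (t - s) := by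
  have hα1 : 0 < 1 - Real.exp (-a) := sub_pos.2 (Real.exp_lt_one_iff.2 (by linarith))
  have h := (convex_Icc s t).norm_image_sub_le_of_norm_hasDerivWithin_le (𝕜 := ℝ)
    (C := (1 - Real.exp (-a))⁻¹ / ε * M)
    (fun r hr => (hz.hasDerivAt_x (by linarith [hr.1] : 0 < r)).hasDerivWithinAt)
    (fun r hr => ?_) (Set.left_mem_Icc.2 hst) (Set.right_mem_Icc.2 hst)
  · rwa [Real.norm_of_nonneg (sub_nonneg.2 hst)] at h
  · have hr1 : 1 ≤ r := hs.trans hr.1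
    refine (norm_le_mul_norm_of_coord (A := (1 - Real.exp (-a))⁻¹ / ε) (x := (z r).2.1)
      (by positivity) fun i => ?_).trans (mul_le_mul_of_nonneg_left (hM r hr) (by positivity))
    have hαr : 1 - Real.exp (-a) ≤ 1 - Real.exp (-a * r) :=
      sub_le_sub_left (Real.exp_le_exp.2 (by nlinarith)) 1
    have hαr0 : 0 < 1 - Real.exp (-a * r) := hα1.trans_le hαr
    simp only [field, abs_neg, abs_div, abs_mul, abs_inv, abs_of_pos hαr0]
    have hD : 0 < ε + Real.sqrt ((1 - Real.exp (-b * r))⁻¹ * (z r).2.2 i) := by positivity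
    rw [abs_of_pos hD, div_mul_eq_mul_div]
    gcongr
    exact le_add_of_nonneg_right (Real.sqrt_nonneg _)

/-! ### Convergence -/

/-- The dissipation rate dominates a fixed multiple of each `m i ^ 2`, which is Lipschitz in time, so
Barbalat's lemma applies to the convergent energy. -/
theorem IsGlobalSolution.tendsto_m (hz : IsGlobalSolution a b ε F S x₀ z)
    (ha : 0 < a) (hb : 0 < b) (hab : b ≤ 4 * a) (hε : 0 < ε)
    (hF : ∀ x, HasGradientAt F (gradient F x) x) (hS : ∀ x i, 0 < S x i) (hco : Coercive F)
    {R M : ℝ} (hB : IsBounded F S z R M) : Tendsto (fun t => (z t).2.1) atTop (𝓝 0) := by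
  obtain ⟨p, hp⟩ := hco.exists_forall_le hF
  choose! w hw hle using fun t ht => hz.exists_hasDerivAt_energy ha hb hab hε hF hS (t := t) ht
  -- the energy converges, being monotone and bounded below
  obtain ⟨l, hl⟩ : ∃ l, Tendsto (fun t => energy a b ε F t (z t)) atTop (𝓝 l) := by
    have hanti := hz.energy_antitoneOn ha hb hab hε hF hS
    have hanti' : Antitone fun t => energy a b ε F (max t 1) (z (max t 1)) := fun s t hst =>
      hanti (Set.mem_Ioi.2 (by positivity)) (Set.mem_Ioi.2 (by positivity))
        (max_le_max_right 1 hst)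
    have hlim := tendsto_atTop_ciInf hanti' ⟨F p, by
      rintro _ ⟨t, rfl⟩
      exact (hp _).trans (le_energy ha hε (by positivity) _)⟩
    refine ⟨_, hlim.congr' ?_⟩
    filter_upwards [eventually_ge_atTop 1] with t ht
    rw [max_eq_left ht]
  refine tendsto_zero_of_coord fun i => ?_
  have hM : 0 ≤ M := (abs_nonneg _).trans (hB.m_le 1 le_rfl i)
  have hβ1 : 0 < 1 - Real.exp (-b) := sub_pos.2 (Real.exp_lt_one_iff.2 (by linarith))
  -- `s` bounds the square root in the denominator for all times `t ≥ 1`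
  set s := Real.sqrt ((1 - Real.exp (-b))⁻¹ * M)
  set κ := ε / (ε + s) ^ 2
  have hκ : 0 < κ := by positivity
  have hκle : ∀ t, 1 ≤ t → w t ≤ -(κ * (z t).2.1 i ^ 2) := by
    intro t ht
    refine (hle t (by linarith)).trans (neg_le_neg ?_)
    refine le_trans ?_ (Finset.single_le_sum (f := fun i => ε * (z t).2.1 i ^ 2 /
      (ε + Real.sqrt ((1 - Real.exp (-b * t))⁻¹ * (z t).2.2 i)) ^ 2)
      (fun j _ => by positivity) (Finset.mem_univ i))
    rw [div_mul_eq_mul_div]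
    have hβt : 1 - Real.exp (-b) ≤ 1 - Real.exp (-b * t) :=
      sub_le_sub_left (Real.exp_le_exp.2 (by nlinarith)) 1
    have hv := (le_abs_self _).trans (hB.v_le t ht i)
    have hv0 := (hz.v_pos hb hS (by linarith : 0 < t) i).le
    have hsqrt : Real.sqrt ((1 - Real.exp (-b * t))⁻¹ * (z t).2.2 i) ≤ s :=
      Real.sqrt_le_sqrt (by gcongr)
    gcongr
  have hd : ∀ t, 1 ≤ t → HasDerivAt (fun t => κ * (z t).2.1 i ^ 2)
      (κ * (2 * (z t).2.1 i * (a * (gradient F (z t).1 i - (z t).2.1 i)))) t := by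
    intro t ht
    refine (((hz.hasDerivAt_m (by linarith : 0 < t) i).pow 2).const_mul κ).congr_deriv ?_
    ring
  have hLip : ∀ r t, 1 ≤ r → r ≤ t →
      |κ * (z t).2.1 i ^ 2 - κ * (z r).2.1 i ^ 2| ≤ κ * (2 * M * (a * (M + M))) * (t - r) := by
    intro r t hr hrt
    have h := (convex_Icc r t).norm_image_sub_le_of_norm_hasDerivWithin_le
      (C := κ * (2 * M * (a * (M + M))))
      (fun q hq => (hd q (hr.trans hq.1)).hasDerivWithinAt)
      (fun q hq => ?_) (Set.left_mem_Icc.2 hrt) (Set.right_mem_Icc.2 hrt)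
    · rwa [Real.norm_of_nonneg (sub_nonneg.2 hrt)] at h
    · have h1 := hB.m_le q (hr.trans hq.1) i
      have h2 := (abs_sub _ _).trans
        (add_le_add (hB.gradient_le q (hr.trans hq.1) i) h1)
      rw [Real.norm_eq_abs, abs_mul, abs_mul, abs_mul, abs_mul, abs_of_pos hκ, abs_two,
        abs_of_pos ha]
      gcongr
  rw [Metric.tendsto_nhds]
  intro δ hδ
  filter_upwards [eventually_lt_of_hasDerivAt_le (fun r hr => hw r (by linarith)) hκle hl hLip
    (by positivity : 0 < κ * δ ^ 2)] with t ht
  rw [Real.dist_eq, sub_zero]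
  exact abs_lt_of_sq_lt_sq (lt_of_mul_lt_mul_left ht hκ.le) hδ.le

/-- Barbalat's lemma applied to the momentum: `m` converges and `m'` is Lipschitz, so
`m' = a (∇F(x) - m)` tends to zero, and hence so does `∇F(x)`. -/
theorem IsGlobalSolution.tendsto_gradient (hz : IsGlobalSolution a b ε F S x₀ z)
    (ha : 0 < a) (hε : 0 < ε)
    {R M C : ℝ} (hB : IsBounded F S z R M) (hC : 0 ≤ C)
    (hGL : ∀ x ∈ Metric.closedBall (0 : E d) R, ∀ y ∈ Metric.closedBall (0 : E d) R,
      ‖gradient F x - gradient F y‖ ≤ C * ‖x - y‖)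
    (hm : Tendsto (fun t => (z t).2.1) atTop (𝓝 0)) :
    Tendsto (fun t => gradient F (z t).1) atTop (𝓝 0) := by
  refine tendsto_zero_of_coord fun i => ?_
  have hmi : Tendsto (fun t => (z t).2.1 i) atTop (𝓝 0) := by
    have := ((EuclideanSpace.proj (𝕜 := ℝ) i).continuous.tendsto 0).comp hm
    rwa [map_zero] at this
  have hM : 0 ≤ M := (abs_nonneg _).trans (hB.m_le 1 le_rfl i)
  have hα1 : 0 < 1 - Real.exp (-a) := sub_pos.2 (Real.exp_lt_one_iff.2 (by linarith))
  set B := M * ‖(WithLp.toLp 2 fun _ => 1 : E d)‖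
  have hmnorm : ∀ t, 1 ≤ t → ‖(z t).2.1‖ ≤ B := fun t ht =>
    norm_le_mul_norm_of_coord hM fun j => by simpa using hB.m_le t ht j
  have hLip : ∀ r t, 1 ≤ r → r ≤ t →
      |a * (gradient F (z t).1 i - (z t).2.1 i) - a * (gradient F (z r).1 i - (z r).2.1 i)| ≤
      a * (C * ((1 - Real.exp (-a))⁻¹ / ε * B) + a * (M + M)) * (t - r) := by
    intro r t hr hrt
    have h1 := hz.norm_x_sub_le ha hε hr hrt (fun q hq => hmnorm q (hr.trans hq.1))
    have h2 : |gradient F (z t).1 i - gradient F (z r).1 i| ≤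
        C * ((1 - Real.exp (-a))⁻¹ / ε * B * (t - r)) :=
      (PiLp.norm_apply_le (gradient F (z t).1 - gradient F (z r).1) i).trans
        ((hGL _ (hB.x_mem t (hr.trans hrt)) _ (hB.x_mem r hr)).trans
          (mul_le_mul_of_nonneg_left h1 hC))
    have h3 := (convex_Icc r t).norm_image_sub_le_of_norm_hasDerivWithin_le (𝕜 := ℝ)
      (C := a * (M + M))
      (fun q hq => (hz.hasDerivAt_m (by linarith [hq.1] : 0 < q) i).hasDerivWithinAt)
      (fun q hq => ?_) (Set.left_mem_Icc.2 hrt) (Set.right_mem_Icc.2 hrt)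
    · rw [Real.norm_of_nonneg (sub_nonneg.2 hrt), Real.norm_eq_abs] at h3
      rw [← mul_sub, abs_mul, abs_of_pos ha, mul_assoc]
      refine mul_le_mul_of_nonneg_left ?_ ha.le
      rw [sub_sub_sub_comm]
      refine (abs_sub _ _).trans ((add_le_add h2 h3).trans_eq ?_)
      ring
    · have h1 := hB.m_le q (hr.trans hq.1) i
      have h2 := (abs_sub _ _).trans
        (add_le_add (hB.gradient_le q (hr.trans hq.1) i) h1)
      rw [Real.norm_eq_abs, abs_mul, abs_of_pos ha]
      gcongr
  have h := tendsto_deriv_zero_of_tendsto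
    (fun r hr => hz.hasDerivAt_m (by linarith : 0 < r) i) hmi hLip
  have h' := (h.const_mul a⁻¹).add hmi
  simpa [inv_mul_cancel_left₀ ha.ne'] using h'

/-- Since `m → 0`, the position slows down, and `v` follows the slowly varying `S(x)`. -/
theorem IsGlobalSolution.tendsto_S_sub_v (hz : IsGlobalSolution a b ε F S x₀ z)
    (ha : 0 < a) (hb : 0 < b) (hε : 0 < ε)
    {R M C : ℝ} (hB : IsBounded F S z R M) (hC : 0 ≤ C)
    (hSL : ∀ x ∈ Metric.closedBall (0 : E d) R, ∀ y ∈ Metric.closedBall (0 : E d) R, ∀ i,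
      |S x i - S y i| ≤ C * ‖x - y‖)
    (hm : Tendsto (fun t => (z t).2.1) atTop (𝓝 0)) :
    Tendsto (fun t => S (z t).1 - (z t).2.2) atTop (𝓝 0) := by
  refine tendsto_zero_of_coord fun i => ?_
  have hα1 : 0 < 1 - Real.exp (-a) := sub_pos.2 (Real.exp_lt_one_iff.2 (by linarith))
  set A := (1 - Real.exp (-a))⁻¹ / ε
  have hA : 0 < A := by positivity
  refine relaxation_tendsto hb (fun r hr => hz.hasDerivAt_v (one_pos.trans_le hr) i)
    (fun r hr => hB.S_le r hr i) fun T hT δ hδ => ?_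
  -- once `‖m‖ ≤ η`, the forcing moves by at most `C A η T ≤ δ` on a window of length `T`
  set η := δ / ((C + 1) * A * T) with hη
  have hη0 : 0 < η := by positivity
  have hηδ : C * (A * η * T) ≤ δ := by
    have : (C + 1) * (A * η * T) = δ := by rw [hη]; field_simp
    nlinarith [mul_pos (mul_pos hA hη0) hT]
  obtain ⟨N, hN⟩ := eventually_atTop.1
    ((hm.norm.eventually_lt_const (by simpa using hη0)).and (eventually_ge_atTop 1))
  filter_upwards [eventually_ge_atTop N] with t ht r hr
  have ht1 := (hN t ht).2
  refine (hSL _ (hB.x_mem r (ht1.trans hr.1)) _ (hB.x_mem t ht1) i).trans (le_trans ?_ hηδ)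
  gcongr
  refine (hz.norm_x_sub_le ha hε ht1 hr.1
    (fun q hq => (hN q (ht.trans hq.1)).1.le)).trans ?_
  gcongr
  linarith [hr.2]

/-- A bounded curve along which the gradient vanishes asymptotically approaches the critical set, by
compactness. -/
theorem tendsto_infDist_criticalSet {x : ℝ → E d} {R C : ℝ} (hC : 0 ≤ C)
    (hGL : ∀ x ∈ Metric.closedBall (0 : E d) R, ∀ y ∈ Metric.closedBall (0 : E d) R,
      ‖gradient F x - gradient F y‖ ≤ C * ‖x - y‖)
    (hx : ∀ t, 1 ≤ t → x t ∈ Metric.closedBall (0 : E d) R)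
    (hG : Tendsto (fun t => gradient F (x t)) atTop (𝓝 0)) :
    Tendsto (fun t => Metric.infDist (x t) (criticalSet F)) atTop (𝓝 0) := by
  have hcont : ContinuousOn (gradient F) (Metric.closedBall (0 : E d) R) :=
    (LipschitzOnWith.of_dist_le_mul (K := ⟨C, hC⟩)
      (fun x hx y hy => by rw [dist_eq_norm, dist_eq_norm]; exact hGL x hx y hy)).continuousOn
  rw [Metric.tendsto_nhds]
  intro δ hδ
  -- the gradient is bounded away from zero on the part of the ball at distance `≥ δ`
  set K := Metric.closedBall (0 : E d) R ∩ {y | δ ≤ Metric.infDist y (criticalSet F)}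
  have hK : IsCompact K := (isCompact_closedBall _ _).inter_right
    (isClosed_le continuous_const (Metric.continuous_infDist_pt _))
  obtain ⟨η, hη, hle⟩ : ∃ η > 0, ∀ y ∈ K, η ≤ ‖gradient F y‖ := by
    rcases K.eq_empty_or_nonempty with h | h
    · exact ⟨1, one_pos, by simp [h]⟩
    · obtain ⟨q, hq, hmin⟩ := hK.exists_isMinOn h (hcont.mono Set.inter_subset_left).norm
      refine ⟨‖gradient F q‖, norm_pos_iff.2 fun h0 => ?_, fun y hy => hmin hy⟩
      have hq0 : Metric.infDist q (criticalSet F) = 0 :=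
        Metric.infDist_zero_of_mem (show q ∈ criticalSet F from h0)
      have := hq.2
      rw [Set.mem_ofPred_eq, hq0] at this
      linarith
  filter_upwards [hG.norm.eventually_lt_const (by simpa using hη), eventually_ge_atTop 1]
    with t h1 h2
  rw [Real.dist_eq, sub_zero, abs_of_nonneg Metric.infDist_nonneg]
  by_contra! h
  exact (hle _ ⟨hx t h2, h⟩).not_gt h1

theorem Coercive.criticalSet_nonempty {F : E d → ℝ} (hco : Coercive F)
    (hF : ∀ x, HasGradientAt F (gradient F x) x) : (criticalSet F).Nonempty := by
  obtain ⟨p, hp⟩ := hco.exists_forall_le hF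
  refine ⟨p, ?_⟩
  have h : IsLocalMin F p := Eventually.of_forall hp
  exact (InnerProductSpace.toDual ℝ (E d)).map_eq_zero_iff.1
    (h.hasFDerivAt_eq_zero (hF p).hasFDerivAt)

end Dynamics

end Adam

theorem mainTheorem2 {d : ℕ} {Ω Ξ : Type*} [MeasurableSpace Ω] [MeasurableSpace Ξ]
    (P : Measure Ω) [IsProbabilityMeasure P] (ξ : Ω → Ξ) (hξ : Measurable ξ)
    (f : Adam.E d → Ξ → ℝ) (hf : Adam.Model P ξ f)
    (hcoercive : Adam.Coercive (Adam.objective P ξ f))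
    (hpos : ∀ x i, 0 < Adam.secondMoment P ξ f x i)
    (αbar βbar : ℝ → ℝ) (a b : ℝ) (hab : Adam.AsymptoticRegime αbar βbar a b)
    (ε : ℝ) (hε : 0 < ε)
    (hcrit : interior (Adam.objective P ξ f '' Adam.criticalSet (Adam.objective P ξ f)) = ∅)
    (x₀ : Adam.E d) (z : ℝ → Adam.Z d)
    (hz : Adam.IsGlobalSolution a b ε (Adam.objective P ξ f) (Adam.secondMoment P ξ f) x₀ z) :
    (Adam.criticalSet (Adam.objective P ξ f)).Nonempty ∧
    Tendsto (fun t => Metric.infDist (z t).1 (Adam.criticalSet (Adam.objective P ξ f)))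
      atTop (𝓝 0) ∧
    Tendsto (fun t => (z t).2.1) atTop (𝓝 0) ∧
    Tendsto (fun t => Adam.secondMoment P ξ f (z t).1 - (z t).2.2) atTop (𝓝 0) := by
  have hF := hf.hasGradientAt_gradient hξ
  obtain ⟨R, M, hB⟩ := hz.exists_isBounded hab.a_pos hab.b_pos hab.b_le hε hF hpos hcoercive
    (hf.exists_lipschitz_gradient hξ) (hf.exists_lipschitz_secondMoment hξ)
  obtain ⟨C₁, hC₁, hGL⟩ := hf.exists_lipschitz_gradient hξ R
  obtain ⟨C₂, hC₂, hSL⟩ := hf.exists_lipschitz_secondMoment hξ R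
  have hm := hz.tendsto_m hab.a_pos hab.b_pos hab.b_le hε hF hpos hcoercive hB
  have hG := hz.tendsto_gradient hab.a_pos hε hB hC₁ hGL hm
  exact ⟨hcoercive.criticalSet_nonempty hF,
    Adam.tendsto_infDist_criticalSet hC₁ hGL hB.x_mem hG, hm,
    hz.tendsto_S_sub_v hab.a_pos hab.b_pos hε hB hC₂ hSL hm⟩
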